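/- Let $\xi$ be an integer-valued random variable with symmetric law, i.e. $\mathbb P(\xi=x)=\mathbb P(\xi=-x)$ for all $x\in\mathbb Z$, let $R$ be the random walk on $\mathbb Z$ whose steps are independent copies of $\xi$, and let $p_{x,y}=\mathbb P(\xi=y-x)$ be its transition probabilities. For a finite nonempty set $A\subset\mathbb Z$ let $T_A=\min\{n>0: R_n\in A\}$, let $\mathbb P_{\pm\infty}$ be the limit, as $y\to\pm\infty$, of the law of the backward path $(R_{T_A-j})_{j\ge 0}$ of the walk started from $y$ (the limit of the probabilities of all cylinder events), and put $\mathbb P_\infty=\frac12(\mathbb P_{+\infty}+\mathbb P_{-\infty})$. The one-dimensional DLA process with paths is the random sequence $(A_n,\Pi_1,\dots,\Pi_n)_{n\ge0}$ with $A_0=\{0\}$ such that, conditionally on $\Pi_1,\dots,\Pi_n$, the backward infinite path $\Pi_{n+1}=(\Pi_{n+1}(-j))_{j\ge0}$ has law $\mathbb P_\infty$ with respect to the set $A_n$, and $A_{n+1}=A_n\cup\{\Pi_{n+1}(-1)\}$. Let $A_\infty=\bigcup_{n\ge 0} A_n$. The $n$-th aggregation tree $\mathcal T_n$ has vertex set $A_n$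 and edges $\{\Pi_i(0),\Pi_i(-1)\}$ for $1\le i\le n$, and $\mathcal T_\infty=\bigcup_{n\ge 0}\mathcal T_n$. Assume that $\mathbb E|\xi|<\infty$ and that for every $k\in\mathbb Z$ there exist constants $c_k,C_k>0$ such that $$c_k<\frac{p_{x,k}}{p_{x,0}}<C_k\qquad\text{for all } x\in\mathbb Z\setminus\{0,k\}$$ (in particular $p_{x,0}>0$ for all $x\ne0$). Then for all $n_0,n_1\in\mathbb Z$, $$\mathbb P\Big(\{n_0\in A_\infty,\ \deg_{\mathcal T_\infty}(n_0)=\infty\}\cap\{n_1\notin A_\infty\ \text{or}\ \deg_{\mathcal T_\infty}(n_1)<\infty\}\Big)=0 .$$ In particular, if almost surely there exists a vertex $n_0$ of $\mathcal T_\infty$ with infinite degree, then almost surely $A_\infty=\mathbb Z$ and all vertices of $\mathcal T_\infty$ have infinite degree. -/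

import Mathlib

open MeasureTheory ProbabilityTheory Filter

namespace DLA

noncomputable section

/-- The one-step transition probability `p_{x,y} = P(ξ = y - x)` of the random walk on `ℤ`
whose step `ξ` has law `p`. -/
def transProb (p : PMF ℤ) (x y : ℤ) : ℝ := (p (y - x)).toReal

/-- The law of the sequence of independent steps `ξ₀, ξ₁, …` of the walk. -/
def stepLaw (p : PMF ℤ) : Measure (ℕ → ℤ) := Measure.infinitePi (fun _ : ℕ => p.toMeasure)

/-- The trajectory `R₀ = y`, `R_n = y + ξ₀ + ⋯ + ξ_{n-1}` built from the steps `s`. -/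
def walk (y : ℤ) (s : ℕ → ℤ) (n : ℕ) : ℤ := y + ∑ i ∈ Finset.range n, s i

/-- `t` is the hitting time `T_A = min {n > 0 : r n ∈ A}` of `A` by the trajectory `r`. -/
def IsHittingTime (A : Finset ℤ) (r : ℕ → ℤ) (t : ℕ) : Prop :=
  IsLeast {n : ℕ | 0 < n ∧ r n ∈ A} t

/-- `P_y(T_A < ∞, T_A ≥ m, R_{T_A - j} = x j for 0 ≤ j ≤ m)`: the probability that the walk
started from `y` hits `A`, and that its last `m + 1` positions up to the hitting time are, read
backwards, `x 0, x 1, …, x m`. -/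
def probFrom (p : PMF ℤ) (A : Finset ℤ) (m : ℕ) (x : ℕ → ℤ) (y : ℤ) : ENNReal :=
  stepLaw p {s | ∃ t : ℕ, IsHittingTime A (walk y s) t ∧ m ≤ t ∧
    ∀ j ≤ m, walk y s (t - j) = x j}

/-- The probability `P_{+∞}(R_{-j} = x j for 0 ≤ j ≤ m)` for the walk started from `+∞` and
stopped on hitting `A`. It is the limit of `probFrom p A m x y` as `y → +∞`, which exists for
every finite nonempty `A` and every aperiodic recurrent walk; it is written as an upper limit so
that the expression is always meaningful. -/
def probPlus (p : PMF ℤ) (A : Finset ℤ) (m : ℕ) (x : ℕ → ℤ) : ENNReal :=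
  limsup (fun y : ℤ => probFrom p A m x y) atTop

/-- The same for `P_{-∞}`, letting `y → -∞`. -/
def probMinus (p : PMF ℤ) (A : Finset ℤ) (m : ℕ) (x : ℕ → ℤ) : ENNReal :=
  limsup (fun y : ℤ => probFrom p A m x y) atBot

/-- `P_∞ = (P_{+∞} + P_{-∞}) / 2`, evaluated on the cylinder `R_{-j} = x j` for `0 ≤ j ≤ m`.
These values determine the law `P_∞` (with respect to `A`) on backward infinite paths. -/
def probInfty (p : PMF ℤ) (A : Finset ℤ) (m : ℕ) (x : ℕ → ℤ) : ℝ :=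
  ((probPlus p A m x).toReal + (probMinus p A m x).toReal) / 2

section Particles

variable {Ω : Type*}

/-- The aggregates of a sequence of particles. Here `path i ω j` is the position of the `i`-th
particle (`i ≥ 1`) at time `-j`; so `path i ω 0` is the site of the aggregate it attempts to jump
onto and `path i ω 1` is the site where it is glued. The value `path 0` is not used. -/
def aggregate (path : ℕ → Ω → ℕ → ℤ) : ℕ → Ω → Finset ℤ
  | 0, _ => {0}
  | n + 1, ω => insert (path (n + 1) ω 1) (aggregate path n ω)

/-- The limit aggregate `A_∞ = ⋃ A_n`. -/
def limitAggregate (path : ℕ → Ω → ℕ → ℤ) (ω : Ω) : Set ℤ :=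
  ⋃ n : ℕ, (aggregate path n ω : Set ℤ)

/-- The σ-field `F_n` generated by the paths of the first `n` particles. -/
@[reducible] def pathSigma (path : ℕ → Ω → ℕ → ℤ) (n : ℕ) : MeasurableSpace Ω :=
  ⨆ i ∈ Finset.Icc 1 n, MeasurableSpace.comap (path i) inferInstance

/-- The one-dimensional DLA process with paths, with respect to the walk with step law `p`:
given the first `n` paths, the next path has law `P_∞` with respect to the aggregate `A_n`. -/
structure IsDLA [MeasurableSpace Ω] (p : PMF ℤ) (μ : Measure Ω)
    (path : ℕ → Ω → ℕ → ℤ) : Prop where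
  measurable_path : ∀ i, Measurable (path i)
  law_path : ∀ (n m : ℕ) (x : ℕ → ℤ),
    μ⟦{ω | ∀ j ≤ m, path (n + 1) ω j = x j} | pathSigma path n⟧
      =ᵐ[μ] fun ω => probInfty p (aggregate path n ω) m x

/-- The `n`-th aggregation tree: its vertices are the points of `A_n`, and its edges join the two
last positions of each of the first `n` particles. (Almost surely the conditions `u ≠ v` and
`u, v ∈ A_n` follow from the last one.) -/
def tree (path : ℕ → Ω → ℕ → ℤ) (n : ℕ) (ω : Ω) : (⊤ : SimpleGraph ℤ).Subgraph where
  verts := aggregate path n ω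
  Adj u v := u ≠ v ∧ u ∈ aggregate path n ω ∧ v ∈ aggregate path n ω ∧
    ∃ i ∈ Finset.Icc 1 n, s(path i ω 0, path i ω 1) = s(u, v)
  adj_sub h := h.1
  edge_vert h := h.2.1
  symm := ⟨fun _ _ h => ⟨h.1.symm, h.2.2.1, h.2.1, by
    obtain ⟨i, hi, e⟩ := h.2.2.2
    exact ⟨i, hi, e.trans Sym2.eq_swap⟩⟩⟩

/-- The limit aggregation tree `⋃ τ_n`; its vertex set is `A_∞`. -/
def limitTree (path : ℕ → Ω → ℕ → ℤ) (ω : Ω) : (⊤ : SimpleGraph ℤ).Subgraph :=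
  ⨆ n : ℕ, tree path n ω

/-- The integer `v` is a vertex of the limit aggregation tree and has infinite degree in it. -/
def HasInfiniteDegree (path : ℕ → Ω → ℕ → ℤ) (ω : Ω) (v : ℤ) : Prop :=
  v ∈ (limitTree path ω).verts ∧ ((limitTree path ω).neighborSet v).Infinite

end Particles

end

end DLA

/-!
Fix `n₀` and `n₁`. Conditionally on the aggregate `A = A_n`, the walk started far away at
`y` lands on `n₀ ∈ A` by a jump from `x` with probability
`killedGreen p A y x * p (n₀ - x)`, where the first factor does not involve `n₀`
(`DLA.probFrom_one`). Two comparisons follow, because `p (n₁ - x) ≥ c * p (n₀ - x)` by the ratio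
hypothesis.

* If `n₁ ∈ A`, redirect the last jump: the particle is glued at `x` by landing on `n₁` at least `c`
  times as likely as by landing on `n₀` (`DLA.probInfty_land_comparison`).
* If `n₁ ∉ A`, make a detour through `n₁`: replacing the jump `x → n₀` by `x → n₁ → n₀` costs the
  constant factor `c * p (n₀ - n₁)`, and then the particle is glued at `n₁`
  (`DLA.probInfty_glue_comparison`).

Both hold for every starting point `y ∉ A`, so they survive the upper limits `y → ±∞`, whether or
not these are limits. Summed over `x` (`DLA.measure_le_of_forall_fibre`), they become inequalities
between conditional probabilities given the past.

The degree of a vertex is infinite exactly when infinitely many particles land on it, because each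
of them is glued at a new site (`DLA.hasInfiniteDegree_iff`). Lévy's conditional Borel–Cantelli
lemma, in the form `DLA.ae_frequently_of_condExp_le`, now gives the result: if infinitely many
particles land on `n₀`, the second comparison excludes `n₁ ∉ A_∞`
(`DLA.ae_mem_limitAggregate`), and the first one then makes infinitely many particles land on `n₁`
(`DLA.ae_frequently_land`).
-/

namespace DLA

/-! ### Paths of the walk killed on hitting the aggregate -/

/-- The walk `R` started from `y` and driven by the steps `s` is at `x` at time `u` and is outside
`A` at all times `1, …, u`. -/
def avoidingVisit (A : Finset ℤ) (y x : ℤ) (u : ℕ) : Set (ℕ → ℤ) :=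
  {s | (∀ i, 0 < i → i ≤ u → walk y s i ∉ A) ∧ walk y s u = x}

/-- The Green function of the walk killed on hitting `A`: the expected number of visits to `x`
strictly before `T_A`, starting from `y`. As in the definition of `T_A`, the position at time `0`
is not tested. -/
noncomputable def killedGreen (p : PMF ℤ) (A : Finset ℤ) (y x : ℤ) : ENNReal :=
  ∑' u, stepLaw p (avoidingVisit A y x u)

/-- The event `E` depends on the first `u` steps only. -/
def DependsOnFirst (E : Set (ℕ → ℤ)) (u : ℕ) : Prop :=
  ∀ s s' : ℕ → ℤ, (∀ i < u, s i = s' i) → s ∈ E → s' ∈ E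

lemma walk_congr {y : ℤ} {s s' : ℕ → ℤ} {n : ℕ} (h : ∀ i < n, s i = s' i) :
    walk y s n = walk y s' n := by
  unfold walk
  rw [Finset.sum_congr rfl fun i hi => h i (Finset.mem_range.1 hi)]

lemma walk_succ (y : ℤ) (s : ℕ → ℤ) (n : ℕ) : walk y s (n + 1) = walk y s n + s n := by
  simp [walk, Finset.sum_range_succ, add_assoc]

lemma dependsOnFirst_avoidingVisit (A : Finset ℤ) (y x : ℤ) (u : ℕ) :
    DependsOnFirst (avoidingVisit A y x u) u := by
  intro s s' h ⟨h1, h2⟩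
  refine ⟨fun i hi hiu => ?_, ?_⟩
  · rw [← walk_congr fun j hj => h j (by omega)]
    exact h1 i hi hiu
  · rw [← walk_congr h, h2]

lemma DependsOnFirst.inter_step {E : Set (ℕ → ℤ)} {u : ℕ} (hE : DependsOnFirst E u) (z : ℤ) :
    DependsOnFirst (E ∩ {s | s u = z}) (u + 1) := fun s s' h hs =>
  ⟨hE s s' (fun i hi => h i (by omega)) hs.1, (h u (by omega)).symm.trans hs.2⟩

/-- A set depending on finitely many steps is the preimage of a set of finite tuples; the latter
is measurable because there are countably many tuples. -/
lemma DependsOnFirst.exists_preimage {E : Set (ℕ → ℤ)} {u : ℕ} (hE : DependsOnFirst E u) :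
    ∃ E' : Set (Finset.range u → ℤ), MeasurableSet E' ∧
      E = (fun (s : ℕ → ℤ) (i : Finset.range u) => s i) ⁻¹' E' := by
  refine ⟨(fun (s : ℕ → ℤ) (i : Finset.range u) => s i) '' E, MeasurableSet.of_discrete, ?_⟩
  refine Set.Subset.antisymm (Set.subset_preimage_image _ _) ?_
  rintro s ⟨s', hs', h⟩
  exact hE s' s (fun i hi => congrFun h ⟨i, Finset.mem_range.2 hi⟩) hs'

lemma DependsOnFirst.measurableSet {E : Set (ℕ → ℤ)} {u : ℕ} (hE : DependsOnFirst E u) :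
    MeasurableSet E := by
  obtain ⟨E', hE', rfl⟩ := hE.exists_preimage
  exact hE'.preimage (by fun_prop)

/-- The Markov property in the form used here: an event of the first `u` steps is independent of
the next step. -/
lemma DependsOnFirst.stepLaw_inter_step (p : PMF ℤ) {E : Set (ℕ → ℤ)} {u : ℕ}
    (hE : DependsOnFirst E u) (z : ℤ) :
    stepLaw p (E ∩ {s | s u = z}) = stepLaw p E * p z := by
  have hind : iIndepFun (fun (i : ℕ) (s : ℕ → ℤ) => s i) (stepLaw p) :=
    iIndepFun_infinitePi (P := fun _ : ℕ => p.toMeasure) (X := fun _ x => x)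
      (fun _ => measurable_id)
  have h2 := hind.indepFun_finset (Finset.range u) {u} (by simp) (fun i => measurable_pi_apply i)
  obtain ⟨E', hE', hEE⟩ := hE.exists_preimage
  have h3 := h2.measure_inter_preimage_eq_mul E' {f | f ⟨u, Finset.mem_singleton_self u⟩ = z}
    hE' MeasurableSet.of_discrete
  rw [← hEE] at h3
  have h4 : stepLaw p {s | s u = z} = p z := by
    have := (measurePreserving_eval_infinitePi (fun _ : ℕ => p.toMeasure) u).measure_preimage
      (MeasurableSet.singleton z).nullMeasurableSet
    rw [PMF.toMeasure_apply_singleton _ _ (MeasurableSet.singleton z)] at this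
    exact this
  rw [← h4]
  exact h3

lemma probFrom_one {p : PMF ℤ} {A : Finset ℤ} {x : ℕ → ℤ} (y : ℤ) (ha : x 0 ∈ A) :
    probFrom p A 1 x y = killedGreen p A y (x 1) * p (x 0 - x 1) := by
  have hset : {s | ∃ t : ℕ, IsHittingTime A (walk y s) t ∧ 1 ≤ t ∧
      ∀ j ≤ 1, walk y s (t - j) = x j} =
      ⋃ u, avoidingVisit A y (x 1) u ∩ {s | s u = x 0 - x 1} := by
    ext s
    simp only [Set.mem_ofPred_eq, Set.mem_iUnion]
    constructor
    · rintro ⟨t, ht, ht1, h⟩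
      obtain ⟨u, rfl⟩ := Nat.exists_eq_add_of_le' ht1
      have h0 := h 0 (by omega)
      have h1 := h 1 le_rfl
      simp only [Nat.sub_zero, Nat.add_sub_cancel] at h0 h1
      refine ⟨u, ⟨fun i hi hiu hA => ?_, h1⟩, ?_⟩
      · have := ht.2 ⟨hi, hA⟩
        omega
      · rw [walk_succ, h1] at h0
        simp only [Set.mem_ofPred_eq]
        omega
    · rintro ⟨u, ⟨h1, h2⟩, h3⟩
      simp only [Set.mem_ofPred_eq] at h3
      have h0 : walk y s (u + 1) = x 0 := by rw [walk_succ, h2, h3]; ring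
      refine ⟨u + 1, ⟨⟨by omega, h0 ▸ ha⟩, fun i hi => ?_⟩, by omega, fun j hj => ?_⟩
      · by_contra hlt
        exact h1 i hi.1 (by omega) hi.2
      · interval_cases j
        · simpa using h0
        · simpa using h2
  have hdisj : Pairwise (Function.onFun Disjoint
      fun u => avoidingVisit A y (x 1) u ∩ {s : ℕ → ℤ | s u = x 0 - x 1}) := by
    refine (Std.Symm.pairwise_on (r := Disjoint) _).2 fun u v huv => Set.disjoint_left.2 ?_
    rintro s ⟨⟨_, h2⟩, h3⟩ ⟨⟨h1, _⟩, _⟩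
    simp only [Set.mem_ofPred_eq] at h3
    refine h1 (u + 1) (by omega) (by omega) ?_
    rwa [walk_succ, h2, h3, add_sub_cancel]
  have hdep := dependsOnFirst_avoidingVisit A y (x 1)
  rw [probFrom, hset, measure_iUnion hdisj fun u => ((hdep u).inter_step _).measurableSet,
    killedGreen, ← ENNReal.tsum_mul_right]
  exact tsum_congr fun u => (hdep u).stepLaw_inter_step p _

lemma probFrom_two {p : PMF ℤ} {A : Finset ℤ} {x : ℕ → ℤ} (y : ℤ) (ha : x 0 ∈ A) (hb : x 1 ∉ A) :
    probFrom p A 2 x y = killedGreen p A y (x 2) * p (x 1 - x 2) * p (x 0 - x 1) := by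
  have hset : {s | ∃ t : ℕ, IsHittingTime A (walk y s) t ∧ 2 ≤ t ∧
      ∀ j ≤ 2, walk y s (t - j) = x j} =
      ⋃ u, avoidingVisit A y (x 2) u ∩ {s | s u = x 1 - x 2} ∩ {s | s (u + 1) = x 0 - x 1} := by
    ext s
    simp only [Set.mem_ofPred_eq, Set.mem_iUnion]
    constructor
    · rintro ⟨t, ht, ht1, h⟩
      obtain ⟨u, rfl⟩ := Nat.exists_eq_add_of_le' ht1
      have h0 : walk y s (u + 1 + 1) = x 0 := h 0 (by omega)
      have h1 : walk y s (u + 1) = x 1 := h 1 (by omega)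
      have h2 : walk y s u = x 2 := h 2 (by omega)
      refine ⟨u, ⟨⟨fun i hi hiu hA => ?_, h2⟩, ?_⟩, ?_⟩
      · have := ht.2 ⟨hi, hA⟩
        omega
      · rw [walk_succ, h2] at h1
        simp only [Set.mem_ofPred_eq]
        omega
      · rw [walk_succ, h1] at h0
        simp only [Set.mem_ofPred_eq]
        omega
    · rintro ⟨u, ⟨⟨h1, h2⟩, h3⟩, h4⟩
      simp only [Set.mem_ofPred_eq] at h3 h4
      have h5 : walk y s (u + 1) = x 1 := by rw [walk_succ, h2, h3]; ring
      have h0 : walk y s (u + 2) = x 0 := by rw [walk_succ, h5, h4]; ring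
      refine ⟨u + 2, ⟨⟨by omega, h0 ▸ ha⟩, fun i hi => ?_⟩, by omega, fun j hj => ?_⟩
      · by_contra hlt
        rcases (show i ≤ u ∨ i = u + 1 by omega) with h | rfl
        · exact h1 i hi.1 h hi.2
        · exact hb (h5 ▸ hi.2)
      · interval_cases j
        · exact h0
        · exact h5
        · exact h2
  have hdisj : Pairwise (Function.onFun Disjoint fun u => avoidingVisit A y (x 2) u ∩
      {s : ℕ → ℤ | s u = x 1 - x 2} ∩ {s | s (u + 1) = x 0 - x 1}) := by
    refine (Std.Symm.pairwise_on (r := Disjoint) _).2 fun u v huv => Set.disjoint_left.2 ?_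
    rintro s ⟨⟨⟨_, h2⟩, h3⟩, h4⟩ ⟨⟨⟨h1, h9⟩, h6⟩, _⟩
    simp only [Set.mem_ofPred_eq] at h3 h4
    have h5 : walk y s (u + 1) = x 1 := by rw [walk_succ, h2, h3]; ring
    have h0 : walk y s (u + 2) = x 0 := by rw [walk_succ, h5, h4]; ring
    rcases (show u + 2 ≤ v ∨ v = u + 1 by omega) with h | rfl
    · exact h1 (u + 2) (by omega) h (h0 ▸ ha)
    · -- If `v = u + 1`, the position at time `u + 2` is `x 0 ∈ A` and also `x 1 ∉ A`.
      simp only [Set.mem_ofPred_eq] at h6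
      have h8 : walk y s (u + 2) = x 1 := by
        rw [walk_succ, h9, h6]
        ring
      exact hb (h8 ▸ h0 ▸ ha)
  have hdep := dependsOnFirst_avoidingVisit A y (x 2)
  rw [probFrom, hset,
    measure_iUnion hdisj fun u => (((hdep u).inter_step _).inter_step _).measurableSet,
    killedGreen, ← ENNReal.tsum_mul_right, ← ENNReal.tsum_mul_right]
  refine tsum_congr fun u => ?_
  rw [((hdep u).inter_step _).stepLaw_inter_step p, (hdep u).stepLaw_inter_step p]

lemma probFrom_eq_zero {p : PMF ℤ} {A : Finset ℤ} {m : ℕ} {x : ℕ → ℤ} (y : ℤ) (ha : x 0 ∉ A) :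
    probFrom p A m x y = 0 := by
  rw [probFrom]
  convert measure_empty (μ := stepLaw p)
  refine Set.eq_empty_of_forall_notMem ?_
  rintro s ⟨t, ht, -, h⟩
  exact ha (h 0 (Nat.zero_le _) ▸ ht.1.2)

lemma killedGreen_eq_zero {p : PMF ℤ} {A : Finset ℤ} {y x : ℤ} (hx : x ∈ A) (hy : y ∉ A) :
    killedGreen p A y x = 0 := by
  refine ENNReal.tsum_eq_zero.2 fun u => ?_
  convert measure_empty (μ := stepLaw p)
  refine Set.eq_empty_of_forall_notMem ?_
  rintro s ⟨h1, h2⟩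
  rcases Nat.eq_zero_or_pos u with rfl | hu
  · simp only [walk, Finset.range_zero, Finset.sum_empty, add_zero] at h2
    exact hy (h2 ▸ hx)
  · exact h1 u hu le_rfl (h2 ▸ hx)

/-! ### Comparison of cylinder probabilities for the walk from infinity -/

lemma eventually_notMem_atTop (A : Finset ℤ) : ∀ᶠ y : ℤ in atTop, y ∉ A := by
  obtain ⟨M, hM⟩ := A.bddAbove
  filter_upwards [eventually_gt_atTop M] with y hy hA
  exact absurd (hM hA) (not_le.2 hy)

lemma eventually_notMem_atBot (A : Finset ℤ) : ∀ᶠ y : ℤ in atBot, y ∉ A := by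
  obtain ⟨M, hM⟩ := A.bddBelow
  filter_upwards [eventually_lt_atBot M] with y hy hA
  exact absurd (hM hA) (not_le.2 hy)

/-- A comparison of cylinder probabilities, valid for every starting point outside `A`, passes to
`P_∞`. Upper limits commute with multiplication by a constant, so no limit has to exist. -/
lemma probInfty_le_probInfty {p : PMF ℤ} {A : Finset ℤ} {m m' : ℕ} {x x' : ℕ → ℤ} {c : ℝ}
    (hc : 0 ≤ c)
    (h : ∀ y, y ∉ A → ENNReal.ofReal c * probFrom p A m x y ≤ probFrom p A m' x' y) :
    c * probInfty p A m x ≤ probInfty p A m' x' := by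
  have key : ∀ l : Filter ℤ, (∀ᶠ y in l, y ∉ A) →
      c * (limsup (fun y : ℤ => probFrom p A m x y) l).toReal ≤
        (limsup (fun y : ℤ => probFrom p A m' x' y) l).toReal := by
    intro l hl
    have hfin : limsup (fun y : ℤ => probFrom p A m' x' y) l ≠ ⊤ := by
      refine ne_top_of_le_ne_top ENNReal.one_ne_top (limsup_le_of_le (h := ?_))
      have : IsProbabilityMeasure (stepLaw p) := by unfold stepLaw; infer_instance
      exact Eventually.of_forall fun y => prob_le_one
    rw [← ENNReal.toReal_ofReal hc, ← ENNReal.toReal_mul,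
      ← ENNReal.limsup_const_mul_of_ne_top ENNReal.ofReal_ne_top]
    exact ENNReal.toReal_mono hfin (limsup_le_limsup (hl.mono h))
  have h1 := key atTop (eventually_notMem_atTop A)
  have h2 := key atBot (eventually_notMem_atBot A)
  unfold probInfty probPlus probMinus
  linarith

lemma probInfty_nonneg (p : PMF ℤ) (A : Finset ℤ) (m : ℕ) (x : ℕ → ℤ) :
    0 ≤ probInfty p A m x := by
  unfold probInfty
  positivity

lemma probInfty_eq_zero {p : PMF ℤ} {A : Finset ℤ} {x : ℕ → ℤ} (h : x 0 ∉ A ∨ x 1 ∈ A) :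
    probInfty p A 1 x = 0 := by
  refine le_antisymm ?_ (probInfty_nonneg ..)
  have h0 : ∀ y, y ∉ A → probFrom p A 1 x y = 0 := by
    intro y hy
    by_cases ha : x 0 ∈ A
    · rw [probFrom_one y ha, killedGreen_eq_zero (h.resolve_left (not_not.2 ha)) hy, zero_mul]
    · exact probFrom_eq_zero y ha
  -- A nonnegative number that is at least twice itself vanishes.
  have := probInfty_le_probInfty (p := p) (m := 1) (m' := 1) (x := x) (x' := x) zero_le_two
    fun y hy => by rw [h0 y hy, mul_zero]
  linarith

/-- The ratio hypothesis, translated: the chances of stepping from `x` to `n₁` and to `n₀` are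
comparable. -/
lemma exists_pmf_ratio {p : PMF ℤ}
    (hratio : ∀ k : ℤ, ∃ c C : ℝ, 0 < c ∧ 0 < C ∧ ∀ x : ℤ, x ≠ 0 → x ≠ k →
      c < transProb p x k / transProb p x 0 ∧ transProb p x k / transProb p x 0 < C)
    (n₀ n₁ : ℤ) :
    ∃ c : ℝ, 0 < c ∧ ∀ x, x ≠ n₀ → x ≠ n₁ → ENNReal.ofReal c * p (n₀ - x) ≤ p (n₁ - x) := by
  obtain ⟨c, _, hc, _, h⟩ := hratio (n₁ - n₀)
  refine ⟨c, hc, fun x h0 h1 => ?_⟩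
  have h2 := (h (x - n₀) (by omega) (by omega)).1
  rw [transProb, transProb, show n₁ - n₀ - (x - n₀) = n₁ - x by ring,
    show 0 - (x - n₀) = n₀ - x by ring] at h2
  have hpos : 0 < (p (n₀ - x)).toReal := by
    rcases (ENNReal.toReal_nonneg (a := p (n₀ - x))).eq_or_lt with h3 | h3
    · rw [← h3, div_zero] at h2
      linarith
    · exact h3
  rw [lt_div_iff₀ hpos] at h2
  rw [← ENNReal.ofReal_toReal (p.apply_ne_top (n₀ - x)),
    ← ENNReal.ofReal_toReal (p.apply_ne_top (n₁ - x)), ← ENNReal.ofReal_mul hc.le]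
  exact ENNReal.ofReal_le_ofReal h2.le

lemma pmf_pos {p : PMF ℤ}
    (hratio : ∀ k : ℤ, ∃ c C : ℝ, 0 < c ∧ 0 < C ∧ ∀ x : ℤ, x ≠ 0 → x ≠ k →
      c < transProb p x k / transProb p x 0 ∧ transProb p x k / transProb p x 0 < C)
    {z : ℤ} (hz : z ≠ 0) : p z ≠ 0 := by
  obtain ⟨c, _, hc, _, h⟩ := hratio (1 - z)
  intro h0
  have h2 := (h (-z) (by omega) (by omega)).1
  rw [transProb, transProb, show 0 - -z = z by ring, h0, ENNReal.toReal_zero, div_zero] at h2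
  linarith

/-- When `n₀` and `n₁` both belong to the aggregate, a particle coming from `x` lands on `n₁` at
least `c` times as likely as on `n₀`. -/
lemma probInfty_land_comparison {p : PMF ℤ} {n₀ n₁ : ℤ} {c : ℝ} (hc : 0 < c)
    (h : ∀ x, x ≠ n₀ → x ≠ n₁ → ENNReal.ofReal c * p (n₀ - x) ≤ p (n₁ - x))
    {A : Finset ℤ} (h0 : n₀ ∈ A) (h1 : n₁ ∈ A) {x x' : ℕ → ℤ} (hx : x 0 = n₀) (hx' : x' 0 = n₁)
    (hxx : x' 1 = x 1) :
    c * probInfty p A 1 x ≤ probInfty p A 1 x' := by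
  refine probInfty_le_probInfty hc.le fun y hy => ?_
  rw [probFrom_one y (hx ▸ h0), probFrom_one y (hx' ▸ h1), hxx, hx, hx']
  by_cases hA : x 1 ∈ A
  · simp [killedGreen_eq_zero hA hy]
  · rw [mul_left_comm]
    gcongr
    exact h _ (fun e => hA (e ▸ h0)) (fun e => hA (e ▸ h1))

/-- When `n₀` belongs to the aggregate and `n₁` does not, a jump from `x` to `n₀` may be replaced
by a jump to `n₁` followed by a jump to `n₀`, at the cost of a constant factor. -/
lemma probInfty_glue_comparison {p : PMF ℤ} {n₀ n₁ : ℤ} {c : ℝ} (hc : 0 < c)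
    (h : ∀ x, x ≠ n₀ → x ≠ n₁ → ENNReal.ofReal c * p (n₀ - x) ≤ p (n₁ - x))
    {A : Finset ℤ} (h0 : n₀ ∈ A) (h1 : n₁ ∉ A) {x x' : ℕ → ℤ} (hx : x 0 = n₀) (hx1 : x 1 ≠ n₁)
    (hx' : x' 0 = n₀) (hx1' : x' 1 = n₁) (hxx : x' 2 = x 1) :
    c * (p (n₀ - n₁)).toReal * probInfty p A 1 x ≤ probInfty p A 2 x' := by
  refine probInfty_le_probInfty (by positivity) fun y hy => ?_
  rw [probFrom_one y (hx ▸ h0), probFrom_two y (hx' ▸ h0) (hx1' ▸ h1), hxx, hx, hx', hx1']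
  by_cases hA : x 1 ∈ A
  · simp [killedGreen_eq_zero hA hy]
  · rw [ENNReal.ofReal_mul hc.le, ENNReal.ofReal_toReal (p.apply_ne_top _)]
    calc ENNReal.ofReal c * p (n₀ - n₁) * (killedGreen p A y (x 1) * p (n₀ - x 1))
        = killedGreen p A y (x 1) * (ENNReal.ofReal c * p (n₀ - x 1)) * p (n₀ - n₁) := by ring
      _ ≤ _ := by
        gcongr
        exact h _ (fun e => hA (e ▸ h0)) hx1

/-! ### Conditional probabilities and Borel–Cantelli -/

section Conditional

variable {Ω : Type*} {m m0 : MeasurableSpace Ω} {μ : Measure Ω}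

/-- An inequality between measures of events, valid on all small `m`-measurable sets, gives the
inequality between conditional probabilities. -/
lemma condExp_indicator_le_of_measure_le [IsFiniteMeasure μ] (hm : m ≤ m0) {D S T : Set Ω}
    (hD : MeasurableSet[m] D) (hS : MeasurableSet S) (hT : MeasurableSet T) {c : ℝ} (hc : 0 ≤ c)
    (h : ∀ B, MeasurableSet[m] B → B ⊆ D → ENNReal.ofReal c * μ (B ∩ S) ≤ μ (B ∩ T)) :
    ∀ᵐ ω ∂μ, ω ∈ D →
      c * (μ[S.indicator (1 : Ω → ℝ) | m]) ω ≤ (μ[T.indicator (1 : Ω → ℝ) | m]) ω := by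
  have hSi : Integrable (S.indicator (1 : Ω → ℝ)) μ := (integrable_const 1).indicator hS
  have hTi : Integrable (T.indicator (1 : Ω → ℝ)) μ := (integrable_const 1).indicator hT
  set f : Ω → ℝ := D.indicator (μ[T.indicator (1 : Ω → ℝ) | m] -
    c • μ[S.indicator (1 : Ω → ℝ) | m]) with hf
  have hfm : StronglyMeasurable[m] f :=
    (stronglyMeasurable_condExp.sub (stronglyMeasurable_condExp.const_smul c)).indicator hD
  have hfi : Integrable f μ :=
    (integrable_condExp.sub (integrable_condExp.smul c)).indicator (hm _ hD)
  have hpos : 0 ≤ᵐ[μ.trim hm] f := by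
    refine ae_nonneg_of_forall_setIntegral_nonneg (hfi.trim hm hfm) fun B hB _ => ?_
    rw [← setIntegral_trim hm hfm hB, hf, setIntegral_indicator (hm _ hD),
      integral_sub' integrable_condExp.integrableOn (integrable_condExp.smul c).integrableOn]
    simp only [Pi.smul_apply]
    rw [integral_smul, setIntegral_condExp hm hTi (hB.inter hD),
      setIntegral_condExp hm hSi (hB.inter hD), integral_indicator_one hT,
      integral_indicator_one hS, measureReal_restrict_apply hT, measureReal_restrict_apply hS,
      smul_eq_mul, sub_nonneg, Set.inter_comm T, Set.inter_comm S]
    have h1 := ENNReal.toReal_mono (measure_ne_top μ _) (h (B ∩ D) (hB.inter hD)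
      Set.inter_subset_right)
    rwa [ENNReal.toReal_mul, ENNReal.toReal_ofReal hc] at h1
  filter_upwards [ae_of_ae_trim hm hpos] with ω hω hωD
  simpa [hf, hωD] using hω

/-- An event splits according to the value of an integer-valued random variable. -/
lemma measure_le_of_forall_fibre {S T : Set Ω} {X Y : Ω → ℤ} (hX : Measurable X)
    (hY : Measurable Y) {c : ENNReal} {B : Set Ω} (hS : MeasurableSet (B ∩ S))
    (hT : MeasurableSet (B ∩ T))
    (h : ∀ x, c * μ (B ∩ (S ∩ X ⁻¹' {x})) ≤ μ (B ∩ (T ∩ Y ⁻¹' {x}))) :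
    c * μ (B ∩ S) ≤ μ (B ∩ T) := by
  have key : ∀ {Z : Ω → ℤ} {U : Set Ω}, Measurable Z → MeasurableSet (B ∩ U) →
      μ (B ∩ U) = ∑' x, μ (B ∩ (U ∩ Z ⁻¹' {x})) := by
    intro Z U hZ hU
    simp_rw [← Set.inter_assoc]
    rw [← measure_iUnion, ← Set.inter_iUnion, ← Set.preimage_iUnion, Set.iUnion_of_singleton,
      Set.preimage_univ, Set.inter_univ]
    · intro x x' hxx
      refine Set.disjoint_left.2 fun ω h1 h2 => hxx ?_
      exact h1.2.symm.trans h2.2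
    · exact fun x => hU.inter (hZ (MeasurableSet.singleton x))
  rw [key hX hS, key hY hT, ← ENNReal.tsum_mul_left]
  exact ENNReal.tsum_le_tsum h

/-- Conditional Borel–Cantelli as a comparison principle: if the conditional probabilities of
`t (n + 1)` dominate those of `s (n + 1)` up to a constant, on events `D n` that eventually occur,
then `t` occurs infinitely often whenever `s` does. -/
lemma ae_frequently_of_condExp_le [IsFiniteMeasure μ] (ℱ : Filtration ℕ m0)
    {s t D : ℕ → Set Ω} (hs : ∀ n, MeasurableSet[ℱ n] (s n)) (ht : ∀ n, MeasurableSet[ℱ n] (t n))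
    {c : ℝ} (hc : 0 < c)
    (h : ∀ n, ∀ᵐ ω ∂μ, ω ∈ D n → c * (μ[(s (n + 1)).indicator (1 : Ω → ℝ) | ℱ n]) ω ≤
      (μ[(t (n + 1)).indicator (1 : Ω → ℝ) | ℱ n]) ω) :
    ∀ᵐ ω ∂μ, (∀ᶠ n in atTop, ω ∈ D n) → (∃ᶠ n in atTop, ω ∈ s n) → ∃ᶠ n in atTop, ω ∈ t n := by
  filter_upwards [ae_mem_limsup_atTop_iff μ hs, ae_mem_limsup_atTop_iff μ ht, ae_all_iff.2 h]
    with ω h1 h2 h3 hD hfs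
  rw [mem_limsup_iff_frequently_mem] at h1 h2
  refine h2.2 ?_
  have h4 := h1.1 hfs
  obtain ⟨N, hN⟩ := eventually_atTop.1 hD
  set a := fun n => (μ[(s (n + 1)).indicator (1 : Ω → ℝ) | ℱ n]) ω
  set b := fun n => (μ[(t (n + 1)).indicator (1 : Ω → ℝ) | ℱ n]) ω
  -- From index `N` on, the partial sums of `b - c a` are nondecreasing.
  have hmono : ∀ n, N ≤ n → ∑ k ∈ Finset.range N, (b k - c * a k) ≤
      ∑ k ∈ Finset.range n, (b k - c * a k) := by
    intro n hn
    induction n, hn using Nat.le_induction with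
    | base => exact le_rfl
    | succ n hn ih =>
      rw [Finset.sum_range_succ]
      have := h3 n (hN n hn)
      linarith
  refine tendsto_atTop_mono' atTop (f₁ := fun n => ∑ k ∈ Finset.range N, (b k - c * a k) +
    c * ∑ k ∈ Finset.range n, a k) ?_ (tendsto_atTop_add_const_left _ _ (h4.const_mul_atTop hc))
  filter_upwards [eventually_ge_atTop N] with n hn
  have := hmono n hn
  rw [Finset.sum_sub_distrib (s := Finset.range n), ← Finset.mul_sum] at this
  linarith

end Conditional

/-! ### Conditional laws of the paths -/

section PathSigma

variable {Ω : Type*} {path : ℕ → Ω → ℕ → ℤ}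

lemma measurable_path_coord {i n : ℕ} (hi : i ∈ Finset.Icc 1 n) (j : ℕ) :
    Measurable[pathSigma path n] fun ω => path i ω j := by
  have h1 : Measurable[pathSigma path n] (path i) := measurable_iff_comap_le.2
    (le_iSup₂ (f := fun i (_ : i ∈ Finset.Icc 1 n) =>
      MeasurableSpace.comap (path i) inferInstance) i hi)
  exact (measurable_pi_apply j).comp h1

lemma measurableSet_mem_aggregate (n : ℕ) (v : ℤ) :
    MeasurableSet[pathSigma path n] {ω | v ∈ aggregate path n ω} := by
  induction n with
  | zero => exact MeasurableSet.const (v ∈ ({0} : Finset ℤ))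
  | succ n ih =>
    have h1 : MeasurableSet[pathSigma path (n + 1)] {ω | path (n + 1) ω 1 = v} :=
      measurable_path_coord (Finset.mem_Icc.2 ⟨by omega, le_rfl⟩) 1 (MeasurableSet.singleton v)
    have h2 : pathSigma path n ≤ pathSigma path (n + 1) := biSup_mono fun _ hi =>
      Finset.mem_Icc.2 ⟨(Finset.mem_Icc.1 hi).1, (Finset.mem_Icc.1 hi).2.trans n.le_succ⟩
    have h3 : {ω | v ∈ aggregate path (n + 1) ω} =
        {ω | path (n + 1) ω 1 = v} ∪ {ω | v ∈ aggregate path n ω} := by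
      ext ω
      simp [aggregate, eq_comm]
    rw [h3]
    exact h1.union (h2 _ ih)

end PathSigma

section PathLaw

variable {Ω : Type*} [MeasurableSpace Ω] {p : PMF ℤ} {μ : Measure Ω} {path : ℕ → Ω → ℕ → ℤ}

/-- The filtration of the first `n` paths. -/
def pathFiltration (hpath : IsDLA p μ path) : Filtration ℕ ‹MeasurableSpace Ω› where
  seq := pathSigma path
  mono' _ _ h := biSup_mono fun _ hi =>
    Finset.mem_Icc.2 ⟨(Finset.mem_Icc.1 hi).1, (Finset.mem_Icc.1 hi).2.trans h⟩
  le' _ := iSup₂_le fun i _ => (hpath.measurable_path i).comap_le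

/-- The event that the `i`-th path starts, read backwards, with `x 0, …, x m`. -/
def pathCylinder (path : ℕ → Ω → ℕ → ℤ) (i m : ℕ) (x : ℕ → ℤ) : Set Ω :=
  {ω | ∀ j ≤ m, path i ω j = x j}

lemma measurable_coord (hpath : IsDLA p μ path) (i j : ℕ) : Measurable fun ω => path i ω j :=
  (measurable_pi_apply j).comp (hpath.measurable_path i)

lemma measurableSet_pathCylinder (hpath : IsDLA p μ path) (i m : ℕ) (x : ℕ → ℤ) :
    MeasurableSet (pathCylinder path i m x) := by
  have : pathCylinder path i m x = ⋂ j ≤ m, (fun ω => path i ω j) ⁻¹' {x j} := by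
    ext ω
    simp [pathCylinder]
  rw [this]
  exact .iInter fun j => .iInter fun _ => measurable_coord hpath i j (MeasurableSet.singleton _)

lemma measureReal_inter_pathCylinder [IsFiniteMeasure μ] (hpath : IsDLA p μ path) {n m : ℕ}
    {x : ℕ → ℤ} {B : Set Ω} (hB : MeasurableSet[pathSigma path n] B) :
    μ.real (B ∩ pathCylinder path (n + 1) m x) =
      ∫ ω in B, probInfty p (aggregate path n ω) m x ∂μ := by
  have hm := (pathFiltration hpath).le n
  have hC := measurableSet_pathCylinder hpath (n + 1) m x
  have hi : Integrable ((pathCylinder path (n + 1) m x).indicator fun _ => (1 : ℝ)) μ :=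
    (integrable_const 1).indicator hC
  have h1 := setIntegral_condExp hm hi hB
  have h2 : ∫ ω in B, (pathCylinder path (n + 1) m x).indicator (fun _ => (1 : ℝ)) ω ∂μ =
      μ.real (B ∩ pathCylinder path (n + 1) m x) := by
    rw [integral_indicator_const _ hC, measureReal_restrict_apply hC, Set.inter_comm]
    simp
  rw [← h2, ← h1]
  refine setIntegral_congr_ae (hm _ hB) ?_
  filter_upwards [hpath.law_path n m x] with ω hω _ using hω

/-- A pointwise comparison of the laws `P_∞` on an event `B` of the past gives a comparison of
probabilities on `B`. -/
lemma measure_inter_pathCylinder_le [IsFiniteMeasure μ] (hpath : IsDLA p μ path) {n m m' : ℕ}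
    {x x' : ℕ → ℤ} {B : Set Ω} (hB : MeasurableSet[pathSigma path n] B) {c : ℝ} (hc : 0 ≤ c)
    (h : ∀ ω ∈ B, c * probInfty p (aggregate path n ω) m x ≤
      probInfty p (aggregate path n ω) m' x') :
    ENNReal.ofReal c * μ (B ∩ pathCylinder path (n + 1) m x) ≤
      μ (B ∩ pathCylinder path (n + 1) m' x') := by
  have hint : ∀ k z, Integrable (fun ω => probInfty p (aggregate path n ω) k z) μ :=
    fun k z => integrable_condExp.congr (hpath.law_path n k z)
  rw [← ofReal_measureReal, ← ENNReal.ofReal_mul hc, ← ofReal_measureReal (s := B ∩ _)]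
  refine ENNReal.ofReal_le_ofReal ?_
  rw [measureReal_inter_pathCylinder hpath hB, measureReal_inter_pathCylinder hpath hB,
    ← integral_const_mul]
  exact setIntegral_mono_on ((hint m x).const_mul c).integrableOn (hint m' x').integrableOn
    ((pathFiltration hpath).le n _ hB) h

/-- Almost surely every particle jumps onto the current aggregate, and is glued at a new site. -/
lemma ae_land_mem_and_glue_notMem [IsFiniteMeasure μ] (hpath : IsDLA p μ path) :
    ∀ᵐ ω ∂μ, ∀ n, path (n + 1) ω 0 ∈ aggregate path n ω ∧
      path (n + 1) ω 1 ∉ aggregate path n ω := by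
  have key : ∀ n (a b : ℤ), ∀ᵐ ω ∂μ, path (n + 1) ω 0 = a → path (n + 1) ω 1 = b →
      a ∈ aggregate path n ω ∧ b ∉ aggregate path n ω := by
    intro n a b
    set x : ℕ → ℤ := fun j => if j = 0 then a else b
    set B : Set Ω := {ω | a ∈ aggregate path n ω}ᶜ ∪ {ω | b ∈ aggregate path n ω}
    have hB : MeasurableSet[pathSigma path n] B :=
      (measurableSet_mem_aggregate n a).compl.union (measurableSet_mem_aggregate n b)
    have h0 : μ.real (B ∩ pathCylinder path (n + 1) 1 x) = 0 := by
      rw [measureReal_inter_pathCylinder hpath hB]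
      exact setIntegral_eq_zero_of_forall_eq_zero fun ω hω => probInfty_eq_zero hω
    rw [measureReal_eq_zero_iff, measure_eq_zero_iff_ae_notMem] at h0
    filter_upwards [h0] with ω hω ha hb
    by_contra hcon
    refine hω ⟨?_, fun j hj => ?_⟩
    · by_cases h1 : a ∈ aggregate path n ω
      · exact Or.inr (by_contra fun h2 => hcon ⟨h1, h2⟩)
      · exact Or.inl h1
    · interval_cases j
      · simpa [x] using ha
      · simpa [x] using hb
  filter_upwards [ae_all_iff.2 fun n => ae_all_iff.2 fun a => ae_all_iff.2 fun b => key n a b]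
    with ω hω n
  exact hω n _ _ rfl rfl

/-! ### Landing and gluing infinitely often -/

/-- If infinitely many particles land on `n₀` and `n₁` belongs to the limit aggregate, then
infinitely many particles land on `n₁`. -/
lemma ae_frequently_land [IsFiniteMeasure μ] (hpath : IsDLA p μ path) {n₀ n₁ : ℤ} {c : ℝ}
    (hc : 0 < c)
    (h : ∀ x, x ≠ n₀ → x ≠ n₁ → ENNReal.ofReal c * p (n₀ - x) ≤ p (n₁ - x)) :
    ∀ᵐ ω ∂μ, (∀ᶠ n in atTop, n₀ ∈ aggregate path n ω ∧ n₁ ∈ aggregate path n ω) →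
      (∃ᶠ n in atTop, 1 ≤ n ∧ path n ω 0 = n₀) → ∃ᶠ n in atTop, 1 ≤ n ∧ path n ω 0 = n₁ := by
  have hmeas : ∀ (a : ℤ) (n : ℕ),
      MeasurableSet[pathFiltration hpath n] {ω | 1 ≤ n ∧ path n ω 0 = a} := by
    intro a n
    by_cases hn : 1 ≤ n
    · simpa only [hn, true_and] using! measurable_path_coord (path := path)
        (Finset.mem_Icc.2 ⟨hn, le_rfl⟩) 0 (MeasurableSet.singleton a)
    · simp [hn]
  refine ae_frequently_of_condExp_le (pathFiltration hpath)
    (s := fun n => {ω | 1 ≤ n ∧ path n ω 0 = n₀}) (t := fun n => {ω | 1 ≤ n ∧ path n ω 0 = n₁})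
    (D := fun n => {ω | n₀ ∈ aggregate path n ω ∧ n₁ ∈ aggregate path n ω})
    (hmeas n₀) (hmeas n₁) hc fun n => ?_
  have hle := (pathFiltration hpath).le
  have hS := hle _ _ (hmeas n₀ (n + 1))
  have hT := hle _ _ (hmeas n₁ (n + 1))
  refine condExp_indicator_le_of_measure_le (hle n)
    ((measurableSet_mem_aggregate n n₀).inter (measurableSet_mem_aggregate n n₁))
    hS hT hc.le fun B hB hBD => ?_
  refine measure_le_of_forall_fibre (measurable_coord hpath (n + 1) 1)
    (measurable_coord hpath (n + 1) 1) ((hle n _ hB).inter hS) ((hle n _ hB).inter hT) fun x => ?_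
  have hset : ∀ a : ℤ, {ω | 1 ≤ n + 1 ∧ path (n + 1) ω 0 = a} ∩
      (fun ω => path (n + 1) ω 1) ⁻¹' {x} =
      pathCylinder path (n + 1) 1 fun j => if j = 0 then a else x := by
    intro a
    ext ω
    simp [pathCylinder, Nat.le_one_iff_eq_zero_or_eq_one]
  rw [hset, hset]
  exact measure_inter_pathCylinder_le hpath hB hc.le fun ω hω =>
    probInfty_land_comparison hc h (hBD hω).1 (hBD hω).2 rfl rfl rfl

/-- If infinitely many particles land on `n₀`, then `n₁` belongs to the limit aggregate. The
particles glued at `n₁` itself are excluded from the comparison, which needs `x ≠ n₁`. -/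
lemma ae_mem_limitAggregate [IsFiniteMeasure μ] (hpath : IsDLA p μ path) {n₀ n₁ : ℤ} {c : ℝ}
    (hc : 0 < c) (hp : p (n₀ - n₁) ≠ 0)
    (h : ∀ x, x ≠ n₀ → x ≠ n₁ → ENNReal.ofReal c * p (n₀ - x) ≤ p (n₁ - x)) :
    ∀ᵐ ω ∂μ, (∀ᶠ n in atTop, n₀ ∈ aggregate path n ω) →
      (∃ᶠ n in atTop, 1 ≤ n ∧ path n ω 0 = n₀) → n₁ ∈ limitAggregate path ω := by
  have hc' : 0 < c * (p (n₀ - n₁)).toReal :=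
    mul_pos hc (ENNReal.toReal_pos hp (p.apply_ne_top _))
  have hmeas : ∀ (V : Set ℤ) (n : ℕ), MeasurableSet[pathFiltration hpath n]
      {ω | 1 ≤ n ∧ path n ω 0 = n₀ ∧ path n ω 1 ∈ V} := by
    intro V n
    by_cases hn : 1 ≤ n
    · have hn' := Finset.mem_Icc.2 ⟨hn, le_rfl⟩
      simpa only [hn, true_and] using!
        (measurable_path_coord (path := path) hn' 0 (MeasurableSet.singleton n₀)).inter
          (measurable_path_coord (path := path) hn' 1 (MeasurableSet.of_discrete (s := V)))
    · simp [hn]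
  have hle := (pathFiltration hpath).le
  have main := ae_frequently_of_condExp_le (μ := μ) (pathFiltration hpath)
    (s := fun n => {ω | 1 ≤ n ∧ path n ω 0 = n₀ ∧ path n ω 1 ∈ ({n₁}ᶜ : Set ℤ)})
    (t := fun n => {ω | 1 ≤ n ∧ path n ω 0 = n₀ ∧ path n ω 1 ∈ ({n₁} : Set ℤ)})
    (D := fun n => {ω | n₀ ∈ aggregate path n ω ∧ n₁ ∉ aggregate path n ω})
    (hmeas _) (hmeas _) hc' fun n => by
      have hS := hle _ _ (hmeas {n₁}ᶜ (n + 1))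
      have hT := hle _ _ (hmeas {n₁} (n + 1))
      refine condExp_indicator_le_of_measure_le (hle n)
        ((measurableSet_mem_aggregate n n₀).inter (measurableSet_mem_aggregate n n₁).compl)
        hS hT hc'.le fun B hB hBD => ?_
      refine measure_le_of_forall_fibre (measurable_coord hpath (n + 1) 1)
        (measurable_coord hpath (n + 1) 2) ((hle n _ hB).inter hS) ((hle n _ hB).inter hT)
        fun x => ?_
      by_cases hx : x = n₁
      · have : {ω | 1 ≤ n + 1 ∧ path (n + 1) ω 0 = n₀ ∧ path (n + 1) ω 1 ∈ ({n₁}ᶜ : Set ℤ)} ∩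
            (fun ω => path (n + 1) ω 1) ⁻¹' {x} = ∅ := by
          ext ω
          simp +contextual [hx]
        rw [this]
        simp
      · have h1 : {ω | 1 ≤ n + 1 ∧ path (n + 1) ω 0 = n₀ ∧ path (n + 1) ω 1 ∈ ({n₁}ᶜ : Set ℤ)} ∩
            (fun ω => path (n + 1) ω 1) ⁻¹' {x} =
            pathCylinder path (n + 1) 1 fun j => if j = 0 then n₀ else x := by
          ext ω
          simp only [pathCylinder, Set.mem_inter_iff, Set.mem_ofPred_eq, Set.mem_preimage,
            Set.mem_singleton_iff, Set.mem_compl_iff, Nat.le_one_iff_eq_zero_or_eq_one,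
            forall_eq_or_imp, forall_eq, if_true, one_ne_zero, if_false]
          refine ⟨fun hh => ⟨hh.1.2.1, hh.2⟩, fun hh => ⟨⟨by omega, hh.1, ?_⟩, hh.2⟩⟩
          rw [hh.2]
          exact hx
        have h2 : {ω | 1 ≤ n + 1 ∧ path (n + 1) ω 0 = n₀ ∧ path (n + 1) ω 1 ∈ ({n₁} : Set ℤ)} ∩
            (fun ω => path (n + 1) ω 2) ⁻¹' {x} =
            pathCylinder path (n + 1) 2
              fun j => if j = 0 then n₀ else if j = 1 then n₁ else x := by
          ext ω
          constructor
          · rintro ⟨⟨_, h3, h4⟩, h5⟩ j hj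
            interval_cases j
            · exact h3
            · exact h4
            · exact h5
          · intro hh
            exact ⟨⟨by omega, hh 0 (by omega), hh 1 (by omega)⟩, hh 2 le_rfl⟩
        rw [h1, h2]
        exact measure_inter_pathCylinder_le hpath hB hc'.le fun ω hω =>
          probInfty_glue_comparison hc h (hBD hω).1 (hBD hω).2 rfl hx rfl rfl rfl
  filter_upwards [main] with ω hω h0 hfreq
  by_contra hn1
  have hnot : ∀ n, n₁ ∉ aggregate path n ω := fun n hn => hn1 (Set.mem_iUnion.2 ⟨n, hn⟩)
  have hglue : ∀ n, 1 ≤ n → path n ω 1 ≠ n₁ := by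
    intro n hn e
    obtain ⟨k, rfl⟩ := Nat.exists_eq_add_of_le' hn
    exact hnot (k + 1) (e ▸ Finset.mem_insert_self _ _)
  obtain ⟨n, hn, -, h3⟩ := (hω (h0.mono fun n hn => ⟨hn, hnot n⟩)
    (hfreq.mono fun n hn => ⟨hn.1, hn.2, hglue n hn.1⟩)).exists
  exact hglue n hn h3

end PathLaw

/-! ### The aggregation tree -/

section Tree

variable {Ω : Type*} {path : ℕ → Ω → ℕ → ℤ} {ω : Ω}

lemma aggregate_mono (path : ℕ → Ω → ℕ → ℤ) (ω : Ω) : Monotone fun n => aggregate path n ω :=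
  monotone_nat_of_le_succ fun _ => Finset.subset_insert _ _

lemma verts_limitTree : (limitTree path ω).verts = limitAggregate path ω := by
  simp [limitTree, limitAggregate, tree]

lemma limitTree_adj_iff
    (hω : ∀ n, path (n + 1) ω 0 ∈ aggregate path n ω ∧ path (n + 1) ω 1 ∉ aggregate path n ω)
    (u v : ℤ) :
    (limitTree path ω).Adj u v ↔ ∃ i, 1 ≤ i ∧ s(path i ω 0, path i ω 1) = s(u, v) := by
  simp only [limitTree, SimpleGraph.Subgraph.iSup_adj]
  constructor
  · rintro ⟨n, -, -, -, i, hi, e⟩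
    exact ⟨i, (Finset.mem_Icc.1 hi).1, e⟩
  · rintro ⟨i, hi, e⟩
    obtain ⟨n, rfl⟩ := Nat.exists_eq_add_of_le' hi
    obtain ⟨h0, h1⟩ := hω n
    have h2 : path (n + 1) ω 0 ∈ aggregate path (n + 1) ω := aggregate_mono path ω n.le_succ h0
    have h3 : path (n + 1) ω 1 ∈ aggregate path (n + 1) ω := Finset.mem_insert_self _ _
    have h4 : path (n + 1) ω 0 ≠ path (n + 1) ω 1 := fun e => h1 (e ▸ h0)
    have h5 : n + 1 ∈ Finset.Icc 1 (n + 1) := Finset.mem_Icc.2 ⟨hi, le_rfl⟩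
    refine ⟨n + 1, ?_⟩
    rcases Sym2.eq_iff.1 e with ⟨rfl, rfl⟩ | ⟨rfl, rfl⟩
    · exact ⟨h4, h2, h3, n + 1, h5, rfl⟩
    · exact ⟨h4.symm, h3, h2, n + 1, h5, Sym2.eq_swap⟩

lemma injOn_glue (hω : ∀ n, path (n + 1) ω 1 ∉ aggregate path n ω) :
    Set.InjOn (fun i => path i ω 1) {i | 1 ≤ i} := by
  have key : ∀ i j, 1 ≤ i → i < j → path i ω 1 ≠ path j ω 1 := by
    intro i j hi hij e
    obtain ⟨m, rfl⟩ := Nat.exists_eq_add_of_le' hi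
    obtain ⟨n, rfl⟩ := Nat.exists_eq_add_of_le' (hi.trans hij.le)
    exact hω n (aggregate_mono path ω (show m + 1 ≤ n by omega)
      (e ▸ Finset.mem_insert_self _ _))
  intro i hi j hj e
  by_contra hne
  rcases lt_or_gt_of_ne hne with h | h
  · exact key i j hi h e
  · exact key j i hj h e.symm

/-- Every particle landing on `v` adds a new neighbour of `v`, and all edges at `v` arise in this
way, except for the one created when `v` itself is added. -/
lemma hasInfiniteDegree_iff
    (hω : ∀ n, path (n + 1) ω 0 ∈ aggregate path n ω ∧ path (n + 1) ω 1 ∉ aggregate path n ω)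
    (v : ℤ) :
    HasInfiniteDegree path ω v ↔ ∃ᶠ i in atTop, 1 ≤ i ∧ path i ω 0 = v := by
  have hinj := injOn_glue fun n => (hω n).2
  rw [HasInfiniteDegree, Nat.frequently_atTop_iff_infinite]
  constructor
  · rintro ⟨-, hinf⟩ hfin
    refine hinf (((hfin.image fun i => path i ω 1).union
      (Set.Subsingleton.finite (s := (fun i => path i ω 0) '' {i | 1 ≤ i ∧ path i ω 1 = v})
        ?_)).subset ?_)
    · exact Set.Subsingleton.image
        (fun i hi j hj => hinj hi.1 hj.1 (hi.2.trans hj.2.symm)) _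
    · intro w hw
      obtain ⟨i, hi, e⟩ := (limitTree_adj_iff hω v w).1 hw
      rcases Sym2.eq_iff.1 e with ⟨h0, h1⟩ | ⟨h0, h1⟩
      · exact Or.inl ⟨i, ⟨hi, h0⟩, h1⟩
      · exact Or.inr ⟨i, ⟨hi, h1⟩, h0⟩
  · intro hinf
    constructor
    · obtain ⟨i, hi, e⟩ := hinf.nonempty
      obtain ⟨n, rfl⟩ := Nat.exists_eq_add_of_le' hi
      rw [verts_limitTree]
      exact Set.mem_iUnion.2 ⟨n, e ▸ (hω n).1⟩
    · refine (hinf.image (hinj.mono fun i hi => hi.1)).mono ?_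
      rintro _ ⟨i, ⟨hi, h0⟩, rfl⟩
      exact (limitTree_adj_iff hω _ _).2 ⟨i, hi, by rw [h0]⟩

lemma eventually_mem_aggregate {v : ℤ} (h : v ∈ limitAggregate path ω) :
    ∀ᶠ n in atTop, v ∈ aggregate path n ω := by
  obtain ⟨n, hn⟩ := Set.mem_iUnion.1 h
  exact eventually_atTop.2 ⟨n, fun k hk => aggregate_mono path ω hk hn⟩

end Tree

lemma ae_hasInfiniteDegree_of_hasInfiniteDegree {Ω : Type*} [MeasurableSpace Ω] {μ : Measure Ω}
    [IsFiniteMeasure μ] {p : PMF ℤ} {path : ℕ → Ω → ℕ → ℤ}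
    (hratio : ∀ k : ℤ, ∃ c C : ℝ, 0 < c ∧ 0 < C ∧ ∀ x : ℤ, x ≠ 0 → x ≠ k →
      c < transProb p x k / transProb p x 0 ∧ transProb p x k / transProb p x 0 < C)
    (hpath : IsDLA p μ path) (n₀ n₁ : ℤ) :
    ∀ᵐ ω ∂μ, HasInfiniteDegree path ω n₀ → HasInfiniteDegree path ω n₁ := by
  rcases eq_or_ne n₀ n₁ with rfl | hne
  · exact .of_forall fun _ => id
  obtain ⟨c, hc, h⟩ := exists_pmf_ratio hratio n₀ n₁
  filter_upwards [ae_land_mem_and_glue_notMem hpath, ae_frequently_land hpath hc h,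
    ae_mem_limitAggregate hpath hc (pmf_pos hratio (sub_ne_zero.2 hne)) h] with ω hω h1 h2 h0
  have hfreq := (hasInfiniteDegree_iff hω n₀).1 h0
  have hev := eventually_mem_aggregate (verts_limitTree ▸ h0.1)
  exact (hasInfiniteDegree_iff hω n₁).2
    (h1 (hev.and (eventually_mem_aggregate (h2 hev hfreq))) hfreq)

end DLA

theorem propositionp {Ω : Type*} [MeasurableSpace Ω] (μ : Measure Ω) [IsProbabilityMeasure μ]
    (p : PMF ℤ)
    (hsymm : ∀ x : ℤ, p (-x) = p x)
    (hmoment : Integrable (fun x : ℤ => |(x : ℝ)|) p.toMeasure)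
    (hratio : ∀ k : ℤ, ∃ c C : ℝ, 0 < c ∧ 0 < C ∧ ∀ x : ℤ, x ≠ 0 → x ≠ k →
      c < DLA.transProb p x k / DLA.transProb p x 0 ∧
        DLA.transProb p x k / DLA.transProb p x 0 < C)
    (path : ℕ → Ω → ℕ → ℤ) (hpath : DLA.IsDLA p μ path) :
    (∀ n₀ n₁ : ℤ,
      μ ({ω | DLA.HasInfiniteDegree path ω n₀} ∩
        {ω | n₁ ∉ DLA.limitAggregate path ω ∨ ¬ DLA.HasInfiniteDegree path ω n₁}) = 0) ∧
    ((∀ᵐ ω ∂μ, ∃ n₀ : ℤ, DLA.HasInfiniteDegree path ω n₀) →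
      ∀ᵐ ω ∂μ, DLA.limitAggregate path ω = Set.univ ∧
        ∀ v ∈ (DLA.limitTree path ω).verts, DLA.HasInfiniteDegree path ω v) := by
  have main := DLA.ae_hasInfiniteDegree_of_hasInfiniteDegree hratio hpath
  constructor
  · intro n₀ n₁
    rw [measure_eq_zero_iff_ae_notMem]
    filter_upwards [main n₀ n₁] with ω hω
    rintro ⟨h0, h1 | h1⟩
    · exact h1 (DLA.verts_limitTree ▸ (hω h0).1)
    · exact h1 (hω h0)
  · intro hex
    filter_upwards [hex, ae_all_iff.2 fun n₀ => ae_all_iff.2 fun n₁ => main n₀ n₁] with ω h0 h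
    obtain ⟨n₀, h0⟩ := h0
    refine ⟨Set.eq_univ_of_forall fun v => DLA.verts_limitTree ▸ (h n₀ v h0).1, fun v _ => ?_⟩
    exact h n₀ v h0
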